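/- Let $p$ be a prime, $q$ a power of $p$, $n \geq 3$, and $L = \mathrm{SL}_n(q)$. Let $L$ act on the space of complex-valued functions on $\mathbb{F}_q^n$ by $(gf)(v) = f(g^{-1}v)$; the character of this permutation representation is the total Weil character $$\tau_n(g) = q^{\dim_{\mathbb{F}_q} \mathrm{Ker}(g-1)} \qquad (g \in L).$$ For a character $\chi : \mathbb{F}_q^\times \to \mathbb{C}^\times$ let $W_\chi$ be the $L$-invariant space of functions $f : \mathbb{F}_q^n \setminus \{0\} \to \mathbb{C}$ such that $f(av) = \chi(a) f(v)$ for all $a \in \mathbb{F}_q^\times$ and $v \neq 0$. The $q-1$ irreducible Weil characters $\tau^0_n, \dots, \tau^{q-2}_n$ of $L$ are the characters of the representations $W_\chi$ for $\chi \neq 1$, and, for $\chi = 1$ (giving $\tau^0_n$), of the quotient of $W_1$ by the line of constant functions on $\mathbb{F}_q^n \setminus \{0\}$. Suppose $\psi$ is a reducible complex character of $L$ such that (a) $\psi(1) = q^n$; (b) $\psi(g) \in \{q^i \mid 0 \leq i \leq n\}$ for all $g \in L$; (c) $[\psi, 1_L]_L = 2$, where $[\varphi,\theta]_L = |L|^{-1}\sum_{g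 \in L} \varphi(g)\overline{\theta(g)}$; (d) every irreducible constituent of $\psi - 2\cdot 1_L$ is one of the irreducible Weil characters $\tau^u_n$, $0 \leq u \leq q-2$. Then $\psi$ is the total Weil character of $L$, and it is the sum of $2 \cdot 1_L$ and all the irreducible Weil characters; that is, $$\psi = \tau_n = 2 \cdot 1_L + \sum_{u=0}^{q-2} \tau^u_n.$$ -/

import Mathlib

noncomputable section

namespace WeilSL

/-! ### Complex characters of finite groups, as functions `G → ℂ` -/

section Characters

variable {G : Type*} [Group G]

/-- `φ` is the character of a finite-dimensional complex representation of `G`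
(up to isomorphism such a representation lives on some `ℂ^d`). -/
def IsCharacter (φ : G → ℂ) : Prop :=
  ∃ (d : ℕ) (ρ : Representation ℂ G (Fin d → ℂ)), φ = ρ.character

/-- `φ` is the character of an irreducible finite-dimensional complex representation of `G`. -/
def IsIrreducibleCharacter (φ : G → ℂ) : Prop :=
  ∃ (d : ℕ) (ρ : Representation ℂ G (Fin d → ℂ)), ρ.IsIrreducible ∧ φ = ρ.character

/-- The usual Hermitian product `[φ, θ] = |G|⁻¹ ∑_g φ(g) conj(θ(g))`. -/
def charInner [Fintype G] (φ θ : G → ℂ) : ℂ :=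
  (Fintype.card G : ℂ)⁻¹ * ∑ g : G, φ g * (starRingEnd ℂ) (θ g)

/-- `φ` is an irreducible constituent of the class function `θ`. -/
def IsIrreducibleConstituent [Fintype G] (φ θ : G → ℂ) : Prop :=
  IsIrreducibleCharacter φ ∧ charInner θ φ ≠ 0

end Characters

/-! ### Weil representations and Weil characters of `SL_n(F)` -/

section Weil

variable (F : Type*) [Field F] (n : ℕ)

/-- The total Weil representation: `SL_n(F)` acting on the complex-valued functions on `F^n`
by `(g f)(v) = f(g⁻¹ v)`. -/
def totalWeilRep :
    Representation ℂ (Matrix.SpecialLinearGroup (Fin n) F) ((Fin n → F) → ℂ) where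
  toFun g := LinearMap.funLeft ℂ ℂ (fun v : Fin n → F => g⁻¹ • v)
  map_one' := by
    ext f v
    simp [LinearMap.funLeft]
  map_mul' g h := by
    ext f v
    simp [LinearMap.funLeft, mul_smul]

@[simp]
theorem totalWeilRep_apply (g : Matrix.SpecialLinearGroup (Fin n) F) (f : (Fin n → F) → ℂ)
    (v : Fin n → F) : totalWeilRep F n g f v = f (g⁻¹ • v) := rfl

/-- The total Weil character `g ↦ q ^ dim Ker (g - 1)`, where `q = |F|`. -/
def totalWeilCharacter (g : Matrix.SpecialLinearGroup (Fin n) F) : ℂ :=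
  (Nat.card F : ℂ) ^
    Module.finrank F (LinearMap.ker (Matrix.toLin' (g : Matrix (Fin n) (Fin n) F) - 1))

/-- The space `W_χ`: functions on `F^n ∖ {0}` (extended by `0` to `F^n`) on which the scalars
act through `χ`, i.e. `f(a v) = χ(a) f(v)`. -/
def eigenspace (χ : Fˣ →* ℂˣ) : Submodule ℂ ((Fin n → F) → ℂ) where
  carrier := {f | f 0 = 0 ∧ ∀ (a : Fˣ) (v : Fin n → F), f (a • v) = (χ a : ℂ) * f v}
  zero_mem' := by simp
  add_mem' := by
    rintro f f' ⟨h0, h⟩ ⟨h0', h'⟩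
    refine ⟨by simp [h0, h0'], fun a v => ?_⟩
    simp [h, h', mul_add]
  smul_mem' := by
    rintro c f ⟨h0, h⟩
    refine ⟨by simp [h0], fun a v => ?_⟩
    simp only [Pi.smul_apply, smul_eq_mul, h]
    ring

theorem eigenspace_invariant (χ : Fˣ →* ℂˣ) (g : Matrix.SpecialLinearGroup (Fin n) F) :
    eigenspace F n χ ≤ (eigenspace F n χ).comap (totalWeilRep F n g) := by
  rintro f ⟨h0, h⟩
  refine ⟨by simp [h0], fun a v => ?_⟩
  simp only [totalWeilRep_apply]
  rw [← h a (g⁻¹ • v)]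
  simp only [Units.smul_def, smul_comm]

/-- `SL_n(F)` acting on `W_χ`. -/
def eigenRep (χ : Fˣ →* ℂˣ) :
    Representation ℂ (Matrix.SpecialLinearGroup (Fin n) F) (eigenspace F n χ) :=
  (totalWeilRep F n).subrepresentation (eigenspace F n χ) (eigenspace_invariant F n χ)

/-- The functions in `W_χ` that are constant on `F^n ∖ {0}`. (For `n ≥ 1` this is the line of
all functions constant on `F^n ∖ {0}` if `χ` is trivial, and it is `0` otherwise.) -/
def constants (χ : Fˣ →* ℂˣ) : Submodule ℂ (eigenspace F n χ) where
  carrier := {f | ∀ v w : Fin n → F, v ≠ 0 → w ≠ 0 → f.1 v = f.1 w}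
  zero_mem' := by simp
  add_mem' := by
    intro f f' h h' v w hv hw
    simp [h v w hv hw, h' v w hv hw]
  smul_mem' := by
    intro c f h v w hv hw
    simp [h v w hv hw]

theorem constants_invariant (χ : Fˣ →* ℂˣ) (g : Matrix.SpecialLinearGroup (Fin n) F) :
    constants F n χ ≤ (constants F n χ).comap (eigenRep F n χ g) := by
  intro f h v w hv hw
  exact h (g⁻¹ • v) (g⁻¹ • w) ((smul_ne_zero_iff_ne _).mpr hv) ((smul_ne_zero_iff_ne _).mpr hw)

/-- The Weil representation of `SL_n(F)` attached to `χ ∈ Irr(F^×)`: it is `W_χ` if `χ ≠ 1`, and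
`W_1` modulo the constant functions on `F^n ∖ {0}` if `χ = 1`. -/
def weilRep (χ : Fˣ →* ℂˣ) :
    Representation ℂ (Matrix.SpecialLinearGroup (Fin n) F)
      (eigenspace F n χ ⧸ constants F n χ) :=
  (eigenRep F n χ).quotient (constants F n χ) (constants_invariant F n χ)

/-- The irreducible Weil character `τ^χ` of `SL_n(F)`; as `χ` runs over the `q - 1` complex
characters of the cyclic group `F^×`, these are `τ^0, …, τ^(q-2)`, with `χ = 1` giving `τ^0`. -/
def weilCharacter (χ : Fˣ →* ℂˣ) : Matrix.SpecialLinearGroup (Fin n) F → ℂ :=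
  (weilRep F n χ).character

end Weil

end WeilSL

end

noncomputable section

namespace WeilSL

open Module

/-! Let N_g(a) be the number of v with gv = av (`eigenCount`). Projecting onto W_χ gives τ^χ(g) =
(q-1)⁻¹ Σ_a χ(a)⁻¹ (N_g(a) - 1) - [χ = 1] (`weilCharacter_apply`); summing over all χ decomposes
τ_n. Write ψ as 2 plus the Weil characters of a multiset t of characters χ. Comparing degrees forces
|t| = q - 1, with χ = 1 occurring once (`eq_and_eq_one_of_mul_eq`). Hence ψ(g) = 1 + Σ_a h(a)(N_g(a)
- 1), where h(a) is the mean of χ(a)⁻¹ over t, so that h(1) = 1, |h| ≤ 1 and h(a⁻¹) is the conjugate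
of h(a).

It remains to see that h(c) = 0 for c ≠ 1, since then ψ(g) = N_g(1) = τ_n(g). The power-of-q
condition is tested on multiplication by X on F[X]/(f), whose eigenspaces are lines, one for each
root of f (`exists_eigenCount_eq`). Taking f = (X-c)^(n-2) times a quadratic without roots yields
h(c) ∈ {0, 1}; taking f = (X-1)^(n-2)(X-c)(X-c⁻¹) excludes 1. -/

/-! ### Decomposition and orthogonality of complex characters. -/

theorem trace_eq_trace_restrict_add_trace_mapQ {k V : Type*} [Field k] [AddCommGroup V] [Module k V]
    [FiniteDimensional k V] (f : V →ₗ[k] V) (p : Submodule k V) (h : p ≤ p.comap f) :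
    LinearMap.trace k V f =
      LinearMap.trace k p (f.restrict h) + LinearMap.trace k (V ⧸ p) (p.mapQ p f h) := by
  -- A linear section s splits V as p ⊕ V/p; the trace of f is then computed by cyclicity on the two
  -- projections.
  obtain ⟨s, hs⟩ := p.mkQ.exists_rightInverse_of_surjective p.range_mkQ
  have hs' : ∀ x, p.mkQ (s x) = x := fun x => LinearMap.congr_fun hs x
  let r : V →ₗ[k] p := (LinearMap.id - s ∘ₗ p.mkQ).codRestrict p fun x => by
    refine (Submodule.Quotient.mk_eq_zero p).mp ?_
    change p.mkQ (x - s (p.mkQ x)) = 0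
    rw [map_sub, hs', sub_self]
  have hr : r ∘ₗ p.subtype = LinearMap.id := by
    ext x
    simp [r, (Submodule.Quotient.mk_eq_zero p).mpr x.2]
  have hid : p.subtype ∘ₗ r + s ∘ₗ p.mkQ = LinearMap.id := by
    ext x
    simp [r]
  have h1 : LinearMap.trace k V (f ∘ₗ (p.subtype ∘ₗ r)) = LinearMap.trace k p (f.restrict h) := by
    rw [← LinearMap.comp_assoc, LinearMap.trace_comp_comm']
    congr 1
    have : f ∘ₗ p.subtype = p.subtype ∘ₗ f.restrict h := by ext x; rfl
    rw [this, ← LinearMap.comp_assoc, hr, LinearMap.id_comp]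
  have h2 : LinearMap.trace k V (f ∘ₗ (s ∘ₗ p.mkQ)) =
      LinearMap.trace k (V ⧸ p) (p.mapQ p f h) := by
    rw [← LinearMap.comp_assoc, LinearMap.trace_comp_comm']
    congr 1
    rw [← LinearMap.comp_assoc, ← Submodule.mapQ_mkQ, LinearMap.comp_assoc, hs, LinearMap.comp_id]
  rw [← h1, ← h2, ← map_add, ← LinearMap.comp_add, hid, LinearMap.comp_id]

variable {G : Type*} [Group G]

/-- The character of an irreducible representation on any finite-dimensional space is an
irreducible character. -/
theorem isIrreducibleCharacter_character {V : Type*} [AddCommGroup V] [Module ℂ V]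
    [FiniteDimensional ℂ V] (ρ : Representation ℂ G V) [hρ : ρ.IsIrreducible] :
    IsIrreducibleCharacter ρ.character := by
  let e : V ≃ₗ[ℂ] (Fin (finrank ℂ V) → ℂ) := (finBasis ℂ V).equivFun
  let σ : Representation ℂ G (Fin (finrank ℂ V) → ℂ) :=
    { toFun := fun g => e.conj (ρ g)
      map_one' := by ext; simp
      map_mul' := fun a b => by ext; simp [LinearEquiv.conj_apply] }
  refine ⟨_, σ, ?_, ?_⟩
  · have hb : (⊥ : Subrepresentation ρ).toSubmodule = ⊥ := rfl
    have ht : (⊤ : Subrepresentation ρ).toSubmodule = ⊤ := rfl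
    have hne : Nontrivial (Subrepresentation σ) := by
      refine ⟨⊥, ⊤, fun h => bot_ne_top (α := Subrepresentation ρ) ?_⟩
      apply Subrepresentation.toSubmodule_injective
      have h' : (⊥ : Submodule ℂ (Fin (finrank ℂ V) → ℂ)) = ⊤ :=
        congrArg Subrepresentation.toSubmodule h
      have := congrArg (Submodule.comap e.toLinearMap) h'
      rwa [Submodule.comap_top, Submodule.comap_bot, LinearEquiv.ker] at this
    refine ⟨fun p => ?_⟩
    have hinj := Submodule.comap_injective_of_surjective (f := e.toLinearMap) e.surjective
    let p' : Subrepresentation ρ := ⟨p.toSubmodule.comap e.toLinearMap, fun g v hv => by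
      have := p.apply_mem_toSubmodule g hv
      simpa [σ, LinearEquiv.conj_apply] using this⟩
    refine (eq_bot_or_eq_top p').imp (fun h => ?_) (fun h => ?_)
    all_goals
      have h' := congrArg Subrepresentation.toSubmodule h
      apply Subrepresentation.toSubmodule_injective
      apply hinj
      refine h'.trans ?_
    · change ⊥ = Submodule.comap e.toLinearMap ⊥
      rw [Submodule.comap_bot, LinearEquiv.ker]
    · rfl
  · ext g
    exact (LinearMap.trace_conj' (ρ g) e).symm

/-- Complete reducibility is not needed: the trace is additive along a proper nonzero
subrepresentation and its quotient, so induction on the dimension suffices. -/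
theorem exists_multiset_sum_irreducible (m : ℕ) {V : Type} [AddCommGroup V] [Module ℂ V]
    [FiniteDimensional ℂ V] (ρ : Representation ℂ G V) (hm : finrank ℂ V = m) :
    ∃ s : Multiset (G → ℂ), (∀ φ ∈ s, IsIrreducibleCharacter φ) ∧ ρ.character = s.sum := by
  induction m using Nat.strong_induction_on generalizing V with
  | _ m ih =>
  by_cases hρ : ρ.IsIrreducible
  · exact ⟨{ρ.character}, by simpa using isIrreducibleCharacter_character ρ, by simp⟩
  by_cases hV : Subsingleton V
  · refine ⟨0, by simp, ?_⟩
    ext g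
    simp [Representation.character, Subsingleton.elim (ρ g) 0]
  rw [not_subsingleton_iff_nontrivial] at hV
  have : ∃ p : Subrepresentation ρ, p ≠ ⊥ ∧ p ≠ ⊤ := by
    by_contra! hcon
    apply hρ
    have : Nontrivial (Subrepresentation ρ) := by
      refine ⟨⊥, ⊤, fun h => ?_⟩
      have := congrArg Subrepresentation.toSubmodule h
      exact bot_ne_top (α := Submodule ℂ V) this
    exact ⟨fun p => or_iff_not_imp_left.mpr (hcon p)⟩
  obtain ⟨p, hp0, hp1⟩ := this
  have hb : p.toSubmodule ≠ ⊥ := fun h => hp0 (Subrepresentation.toSubmodule_injective h)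
  have ht : p.toSubmodule ≠ ⊤ := fun h => hp1 (Subrepresentation.toSubmodule_injective h)
  have hadd := Submodule.finrank_quotient_add_finrank p.toSubmodule
  have hlt := Submodule.finrank_lt ht
  have hpos : 0 < finrank ℂ p.toSubmodule := by
    rw [Module.finrank_pos_iff]
    exact Submodule.nontrivial_iff_ne_bot.mpr hb
  obtain ⟨s, hs, hs'⟩ := ih _ (by omega)
    (ρ.subrepresentation p.toSubmodule fun g v hv => p.apply_mem_toSubmodule g hv) rfl
  obtain ⟨t, ht, ht'⟩ := ih _ (by omega)
    (ρ.quotient p.toSubmodule fun g v hv => p.apply_mem_toSubmodule g hv) rfl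
  refine ⟨s + t, fun φ hφ => (Multiset.mem_add.mp hφ).elim (hs φ) (ht φ), ?_⟩
  rw [Multiset.sum_add, ← hs', ← ht']
  ext g
  exact trace_eq_trace_restrict_add_trace_mapQ (ρ g) p.toSubmodule
    fun v hv => p.apply_mem_toSubmodule g hv

/-- Unitarity trick: H = Σ_a M(a)* M(a) is positive definite and H M(g) = M(g⁻¹)* H, so M(g) is
similar to M(g⁻¹)* and has the same trace. -/
theorem character_inv_eq_conj [Fintype G] {d : ℕ} (ρ : Representation ℂ G (Fin d → ℂ)) (g : G) :
    ρ.character g⁻¹ = starRingEnd ℂ (ρ.character g) := by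
  let M : G → Matrix (Fin d) (Fin d) ℂ := fun g => LinearMap.toMatrix' (ρ g)
  have hM : ∀ a b, M (a * b) = M a * M b := fun a b => by
    simp [M, LinearMap.toMatrix'_mul]
  have hM1 : M 1 = 1 := by simp [M]
  have htr : ∀ a, ρ.character a = (M a).trace := fun a => by
    simp [M, Representation.character, LinearMap.trace_eq_matrix_trace ℂ (Pi.basisFun ℂ (Fin d)),
      LinearMap.toMatrix_eq_toMatrix']
  let H : Matrix (Fin d) (Fin d) ℂ := ∑ a, (M a).conjTranspose * M a
  have hH : IsUnit H := by
    open ComplexOrder in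
    refine Matrix.PosDef.isUnit (Matrix.posDef_sum ⟨1, Finset.mem_univ 1⟩ fun a _ => ?_)
    refine Matrix.PosDef.conjTranspose_mul_self _ (Function.LeftInverse.injective
      (g := (M a⁻¹).mulVec) fun v => ?_)
    rw [Matrix.mulVec_mulVec, ← hM, inv_mul_cancel, hM1, Matrix.one_mulVec]
  have hcomm : H * M g = (M g⁻¹).conjTranspose * H := by
    simp only [H, Finset.sum_mul, Finset.mul_sum]
    refine Fintype.sum_equiv (Equiv.mulRight g) _ _ fun a => ?_
    simp only [Equiv.coe_mulRight]
    rw [← Matrix.mul_assoc, ← Matrix.conjTranspose_mul, ← hM, hM a g, Matrix.mul_assoc]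
    simp
  obtain ⟨u, hu⟩ := hH
  have : M g = (↑u⁻¹ : Matrix (Fin d) (Fin d) ℂ) * ((M g⁻¹).conjTranspose * u) := by
    rw [hu, ← hcomm, ← hu, ← Matrix.mul_assoc]
    simp
  rw [htr, htr, this, Matrix.trace_mul_comm, Matrix.mul_assoc]
  simp

theorem charInner_irreducible [Fintype G] {φ θ : G → ℂ} [Decidable (φ = θ)]
    (hφ : IsIrreducibleCharacter φ)
    (hθ : IsIrreducibleCharacter θ) : charInner φ θ = if φ = θ then 1 else 0 := by
  classical
  obtain ⟨d, ρ, hρ, rfl⟩ := hφ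
  obtain ⟨e, σ, hσ, hσ'⟩ := hθ
  have : Invertible (Nat.card G : ℂ) := invertibleOfNonzero (by simp)
  have key : ∀ {d e : ℕ} (ρ : Representation ℂ G (Fin d → ℂ)) (σ : Representation ℂ G (Fin e → ℂ))
     [ρ.IsIrreducible] [σ.IsIrreducible],
     charInner ρ.character σ.character = if Nonempty (σ.Equiv ρ) then 1 else 0 := by
    intro d e ρ σ _ _
    rw [← Representation.char_orthonormal ρ σ, charInner, Nat.card_eq_fintype_card]
    simp [character_inv_eq_conj]
  split_ifs with h
  · rw [← h, key, if_pos ⟨Representation.Equiv.refl _⟩]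
  · subst hσ'
    rw [key, if_neg]
    rintro ⟨f⟩
    exact h (Representation.char_iso f).symm

theorem isIrreducibleCharacter_one : IsIrreducibleCharacter (1 : G → ℂ) := by
  have hs : IsSimpleOrder (Submodule ℂ (Fin 1 → ℂ)) :=
    is_simple_module_of_finrank_eq_one (K := ℂ) (Module.finrank_fin_fun ℂ)
  refine ⟨1, Representation.trivial ℂ G (Fin 1 → ℂ), ?_, ?_⟩
  · have hne : Nontrivial (Subrepresentation (Representation.trivial ℂ G (Fin 1 → ℂ))) :=
      ⟨⊥, ⊤, fun h => bot_ne_top (α := Submodule ℂ (Fin 1 → ℂ))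
        (congrArg Subrepresentation.toSubmodule h)⟩
    exact ⟨fun p => (eq_bot_or_eq_top p.toSubmodule).imp
      (fun h => Subrepresentation.toSubmodule_injective h)
      (fun h => Subrepresentation.toSubmodule_injective h)⟩
  · ext g
    have : Representation.trivial ℂ G (Fin 1 → ℂ) g = LinearMap.id := by ext; simp
    simp [Representation.character, this]

theorem charInner_sub_left {G : Type*} [Fintype G] (φ φ' θ : G → ℂ) :
    charInner (φ - φ') θ = charInner φ θ - charInner φ' θ := by
  simp [charInner, sub_mul, mul_sub]

theorem charInner_smul_left {G : Type*} [Fintype G] (m : ℕ) (φ θ : G → ℂ) :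
    charInner (m • φ) θ = m * charInner φ θ := by
  simp [charInner, Finset.mul_sum]
  refine Finset.sum_congr rfl fun g _ => ?_
  ring

theorem charInner_multiset_sum [Fintype G] [DecidableEq (G → ℂ)] (s : Multiset (G → ℂ)) {θ : G → ℂ}
    (hs : ∀ φ ∈ s, IsIrreducibleCharacter φ) (hθ : IsIrreducibleCharacter θ) :
    charInner s.sum θ = s.count θ := by
  induction s using Multiset.induction_on with
  | empty => simp [charInner]
  | cons φ s ih =>
    have hadd : charInner (φ + s.sum) θ = charInner φ θ + charInner s.sum θ := by
      simp [charInner, add_mul, Finset.sum_add_distrib, mul_add]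
    rw [Multiset.sum_cons, hadd, ih fun x hx => hs x (Multiset.mem_cons_of_mem hx),
      charInner_irreducible (hs φ (Multiset.mem_cons_self φ s)) hθ, Multiset.count_cons]
    simp only [eq_comm (a := θ)]
    split_ifs <;> push_cast <;> ring

/-- A character is the sum of `m` trivial characters, where `m = [ψ, 1]`, and of irreducible
constituents of `ψ - m • 1`. -/
theorem exists_multiset_constituents [Fintype G] {ψ : G → ℂ} (hψ : IsCharacter ψ) {m : ℕ}
    (hm : charInner ψ 1 = m) :
    ∃ s : Multiset (G → ℂ), (∀ φ ∈ s, IsIrreducibleConstituent φ (ψ - m • 1)) ∧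
      ψ = m • 1 + s.sum := by
  classical
  obtain ⟨d, ρ, rfl⟩ := hψ
  obtain ⟨s, hs, hs'⟩ := exists_multiset_sum_irreducible d ρ (by simp)
  have hcount : s.count 1 = m := by
    rw [hs', charInner_multiset_sum s hs isIrreducibleCharacter_one] at hm
    exact_mod_cast hm
  have hsplit : s = Multiset.replicate m 1 + s.filter (· ≠ 1) := by
    rw [← hcount, ← Multiset.filter_eq', Multiset.filter_add_not]
  refine ⟨s.filter (· ≠ 1), fun φ hφ => ?_, ?_⟩
  · obtain ⟨hφs, hφ1⟩ := Multiset.mem_filter.mp hφ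
    refine ⟨hs φ hφs, ?_⟩
    rw [charInner_sub_left, charInner_smul_left, hs', charInner_multiset_sum s hs (hs φ hφs),
      charInner_irreducible isIrreducibleCharacter_one (hs φ hφs), if_neg (Ne.symm hφ1)]
    simpa using hφs
  · rw [hs']
    conv_lhs => rw [hsplit]
    simp

theorem trace_mapQ_eq_sub_finrank {k V : Type*} [Field k] [AddCommGroup V] [Module k V]
    [FiniteDimensional k V] (f : V →ₗ[k] V) (p : Submodule k V) (h : p ≤ p.comap f)
    (hf : ∀ x ∈ p, f x = x) :
    LinearMap.trace k (V ⧸ p) (p.mapQ p f h) = LinearMap.trace k V f - finrank k p := by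
  have hid : f.restrict h = LinearMap.id := by
    ext x
    exact hf x x.2
  rw [trace_eq_trace_restrict_add_trace_mapQ f p h, hid, LinearMap.trace_id, add_sub_cancel_left]

/-! ### Eigenvector counts. -/

section EigenCount

variable {F : Type*} [Field F] {n : ℕ}

/-- The number of vectors `v` with `g v = a v`. -/
def eigenCount (g : Matrix.SpecialLinearGroup (Fin n) F) (a : F) : ℕ :=
  Nat.card {v : Fin n → F // g • v = a • v}

theorem totalWeilCharacter_eq_eigenCount [Fintype F] (g : Matrix.SpecialLinearGroup (Fin n) F) :
    totalWeilCharacter F n g = eigenCount g 1 := by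
  have h : eigenCount g 1 =
      Nat.card (LinearMap.ker (Matrix.toLin' (g : Matrix (Fin n) (Fin n) F) - 1)) := by
    refine Nat.card_congr (Equiv.subtypeEquivRight fun v => ?_)
    rw [LinearMap.mem_ker, LinearMap.sub_apply, sub_eq_zero, one_smul]
    rfl
  rw [h, Module.natCard_eq_pow_finrank (K := F), totalWeilCharacter]
  push_cast
  rfl

theorem eigenCount_one [Fintype F] [DecidableEq F] (a : F) :
    eigenCount (1 : Matrix.SpecialLinearGroup (Fin n) F) a =
      if a = 1 then Fintype.card F ^ n else 1 := by
  split_ifs with h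
  · simp [eigenCount, h]
  · rw [eigenCount, Nat.card_eq_one_iff_unique]
    refine ⟨⟨fun v w => ?_⟩, ⟨⟨0, by simp⟩⟩⟩
    have key : ∀ v : Fin n → F, (1 : Matrix.SpecialLinearGroup (Fin n) F) • v = a • v → v = 0 := by
      intro v hv
      have h' : (1 - a) • v = 0 := by rw [sub_smul, one_smul, ← hv, one_smul, sub_self]
      exact (smul_eq_zero.mp h').resolve_left (sub_ne_zero.mpr (Ne.symm h))
    rw [Subtype.ext_iff, key _ v.2, key _ w.2]

end EigenCount

/-! ### Values of the Weil characters. -/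

section Trace

variable {F : Type*} [Field F] [Fintype F] [DecidableEq F] {n : ℕ}

/-- The projection of the functions on `F^n` onto `eigenspace F n χ`. -/
def eigenProjection (χ : Fˣ →* ℂˣ) : ((Fin n → F) → ℂ) →ₗ[ℂ] ((Fin n → F) → ℂ) where
  toFun f v := if v = 0 then 0 else
    (Fintype.card Fˣ : ℂ)⁻¹ * ∑ a : Fˣ, ((χ a : ℂ))⁻¹ * f (a • v)
  map_add' f f' := by
    ext v
    simp only [Pi.add_apply, mul_add, Finset.sum_add_distrib]
    split_ifs <;> simp
  map_smul' c f := by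
    ext v
    simp only [Pi.smul_apply, smul_eq_mul, RingHom.id_apply, mul_left_comm _ c, ← Finset.mul_sum]
    split_ifs <;> simp

theorem eigenProjection_apply (χ : Fˣ →* ℂˣ) (f : (Fin n → F) → ℂ) (v : Fin n → F) :
    eigenProjection χ f v = if v = 0 then 0 else
    (Fintype.card Fˣ : ℂ)⁻¹ * ∑ a : Fˣ, ((χ a : ℂ))⁻¹ * f (a • v) := rfl

theorem eigenProjection_mem (χ : Fˣ →* ℂˣ) (f : (Fin n → F) → ℂ) :
    eigenProjection χ f ∈ eigenspace F n χ := by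
  refine ⟨by simp [eigenProjection_apply], fun b v => ?_⟩
  simp only [eigenProjection_apply, smul_eq_zero_iff_eq]
  split_ifs
  · simp
  · rw [mul_left_comm]
    congr 1
    rw [Finset.mul_sum]
    refine Fintype.sum_equiv (Equiv.mulRight b) _ _ fun a => ?_
    simp only [Equiv.coe_mulRight, map_mul, Units.val_mul, mul_inv, mul_smul]
    field_simp

theorem eigenProjection_eq_self (χ : Fˣ →* ℂˣ) {f : (Fin n → F) → ℂ}
    (hf : f ∈ eigenspace F n χ) : eigenProjection χ f = f := by
  ext v
  rw [eigenProjection_apply]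
  split_ifs with h
  · rw [h, hf.1]
  · simp [hf.2]

/-- In the basis of delta functions, the diagonal entry at v ≠ 0 averages χ(a)⁻¹ over the a with gv
= av. The entry at v = 0 vanishes, whence the -1. -/
theorem trace_totalWeilRep_comp_eigenProjection (χ : Fˣ →* ℂˣ)
    (g : Matrix.SpecialLinearGroup (Fin n) F) :
    LinearMap.trace ℂ _ (totalWeilRep F n g ∘ₗ eigenProjection χ) =
      (Fintype.card Fˣ : ℂ)⁻¹ * ∑ a : Fˣ, ((χ a : ℂ))⁻¹ * ((eigenCount g (a : F) : ℂ) - 1) := by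
  rw [LinearMap.trace_eq_matrix_trace ℂ (Pi.basisFun ℂ (Fin n → F)), Matrix.trace]
  have hcount : ∀ a : Fˣ, (eigenCount g (a : F) : ℂ) - 1 =
      ∑ v : Fin n → F, if v = 0 then 0 else if a • g⁻¹ • v = v then 1 else 0 := by
    intro a
    have h0 : (eigenCount g (a : F) : ℂ) = ∑ v : Fin n → F, if a • g⁻¹ • v = v then 1 else 0 := by
      rw [Finset.sum_boole, eigenCount, Nat.card_eq_fintype_card, Fintype.card_subtype]
      congr 2
      ext v
      simp only [Finset.mem_filter, Finset.mem_univ, true_and]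
      rw [Units.smul_def, ← smul_comm g⁻¹ (a : F) v, inv_smul_eq_iff, eq_comm]
    have h1 : (1 : ℂ) = ∑ v : Fin n → F, if v = 0 then 1 else 0 := by simp
    rw [h0, h1, ← Finset.sum_sub_distrib]
    refine Finset.sum_congr rfl fun v _ => ?_
    by_cases hv : v = 0 <;> simp [hv]
  simp only [hcount, Finset.mul_sum]
  rw [Finset.sum_comm]
  refine Finset.sum_congr rfl fun v _ => ?_
  simp only [Matrix.diag_apply, LinearMap.toMatrix_apply, Pi.basisFun_apply, Pi.basisFun_repr,
    LinearMap.comp_apply, totalWeilRep_apply, eigenProjection_apply, smul_eq_zero_iff_eq]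
  split_ifs
  · simp
  · simp [Finset.mul_sum, Pi.single_apply]

/-- The composite of g with the projection has image in W_χ and restricts there to g, so both have
the same trace. -/
theorem character_eigenRep (χ : Fˣ →* ℂˣ) (g : Matrix.SpecialLinearGroup (Fin n) F) :
    (eigenRep F n χ).character g =
      (Fintype.card Fˣ : ℂ)⁻¹ * ∑ a : Fˣ, ((χ a : ℂ))⁻¹ * ((eigenCount g (a : F) : ℂ) - 1) := by
  have h : ∀ f, (totalWeilRep F n g ∘ₗ eigenProjection χ) f ∈ eigenspace F n χ :=
    fun f => eigenspace_invariant F n χ g (eigenProjection_mem χ f)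
  rw [← trace_totalWeilRep_comp_eigenProjection,
    ← LinearMap.trace_restrict_eq_of_forall_mem (eigenspace F n χ) _ h, Representation.character]
  congr 1
  ext f : 2
  change totalWeilRep F n g f = totalWeilRep F n g (eigenProjection χ f)
  rw [eigenProjection_eq_self χ f.2]

theorem finrank_constants [DecidableEq (Fˣ →* ℂˣ)] (hn : 1 ≤ n) (χ : Fˣ →* ℂˣ) :
    finrank ℂ (constants F n χ) = if χ = 1 then 1 else 0 := by
  have : NeZero n := ⟨by omega⟩
  obtain ⟨w, hw⟩ : ∃ w : Fin n → F, w ≠ 0 := exists_ne 0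
  split_ifs with h
  · subst h
    let e : eigenspace F n 1 := ⟨fun v => if v = 0 then 0 else 1, by simp, fun a v => by
      simp [smul_eq_zero_iff_eq]⟩
    have he : e ∈ constants F n 1 := fun v w hv hw => by simp [e, hv, hw]
    refine finrank_eq_one (⟨e, he⟩ : constants F n 1) (fun h => ?_) fun f => ⟨f.1.1 w, ?_⟩
    · have := congrFun (congrArg (fun f : constants F n 1 => f.1.1) h) w
      simp [e, hw] at this
    · ext v
      by_cases hv : v = 0
      · subst hv
        simp [e, f.1.2.1]
      · simp [e, hv, f.2 v w hv hw]
  · obtain ⟨a, ha⟩ : ∃ a, χ a ≠ 1 := by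
      by_contra! hcon
      exact h (MonoidHom.ext hcon)
    have : Subsingleton (constants F n χ) := by
      refine subsingleton_of_forall_eq 0 fun f => ?_
      ext v
      by_cases hv : v = 0
      · subst hv
        simp [f.1.2.1]
      · have h1 := f.1.2.2 a v
        rw [f.2 (a • v) v ((smul_ne_zero_iff_ne a).mpr hv) hv] at h1
        have h2 : ((χ a : ℂ) - 1) * f.1.1 v = 0 := by rw [sub_mul, ← h1, one_mul, sub_self]
        refine (mul_eq_zero.mp h2).resolve_left fun h3 => ha ?_
        exact Units.ext (sub_eq_zero.mp h3)
    exact finrank_zero_of_subsingleton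

/-- g fixes the constants pointwise, so passing to the quotient subtracts their dimension from the
trace. -/
theorem weilCharacter_apply [DecidableEq (Fˣ →* ℂˣ)] (hn : 1 ≤ n) (χ : Fˣ →* ℂˣ)
    (g : Matrix.SpecialLinearGroup (Fin n) F) :
    weilCharacter F n χ g =
      (Fintype.card Fˣ : ℂ)⁻¹ * ∑ a : Fˣ, ((χ a : ℂ))⁻¹ * ((eigenCount g (a : F) : ℂ) - 1) -
        if χ = 1 then 1 else 0 := by
  have h := trace_mapQ_eq_sub_finrank (eigenRep F n χ g) (constants F n χ)
    (constants_invariant F n χ g) fun f hf => by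
      ext v
      change f.1 (g⁻¹ • v) = f.1 v
      by_cases hv : v = 0
      · simp [hv]
      · exact hf _ _ ((smul_ne_zero_iff_ne _).mpr hv) hv
  rw [finrank_constants hn] at h
  rw [← character_eigenRep]
  refine h.trans ?_
  simp [Representation.character]

theorem sum_monoidHom_apply_inv [Fintype (Fˣ →* ℂˣ)] (a : Fˣ) :
    ∑ χ : Fˣ →* ℂˣ, ((χ a : ℂ))⁻¹ = if a = 1 then (Fintype.card Fˣ : ℂ) else 0 := by
  split_ifs with h
  · have : Fintype.card (Fˣ →* ℂˣ) = Fintype.card Fˣ := by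
      simpa using CommGroup.card_monoidHom_of_hasEnoughRootsOfUnity Fˣ ℂ
    simp [h, this]
  · obtain ⟨χ₀, h0⟩ := CommGroup.exists_apply_ne_one_of_hasEnoughRootsOfUnity Fˣ ℂ h
    have hs : ((χ₀ a : ℂ))⁻¹ * ∑ χ : Fˣ →* ℂˣ, ((χ a : ℂ))⁻¹ = ∑ χ : Fˣ →* ℂˣ, ((χ a : ℂ))⁻¹ := by
      rw [Finset.mul_sum]
      refine Fintype.sum_equiv (Equiv.mulLeft χ₀) _ _ fun χ => ?_
      simp [mul_comm]
    by_contra hne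
    have := mul_eq_right₀ hne |>.mp hs
    exact h0 (Units.ext (by simpa using this))

/-- The total Weil character is the sum of two trivial characters and all Weil characters. -/
theorem totalWeilCharacter_eq_add_sum (hn : 1 ≤ n) :
    totalWeilCharacter F n = 2 • 1 + ∑ᶠ χ : Fˣ →* ℂˣ, weilCharacter F n χ := by
  classical
  have hfin : Finite (Fˣ →* ℂˣ) := inferInstance
  let _ : Fintype (Fˣ →* ℂˣ) := Fintype.ofFinite _
  have hc : (Fintype.card Fˣ : ℂ) ≠ 0 := by simp
  rw [finsum_eq_sum_of_fintype]
  ext g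
  simp only [Pi.add_apply, Finset.sum_apply, weilCharacter_apply hn, Finset.sum_sub_distrib,
    ← Finset.mul_sum]
  -- By orthogonality only a = 1 survives, leaving 2 + (N_g(1) - 1) - 1.
  rw [Finset.sum_comm]
  simp only [← Finset.sum_mul, sum_monoidHom_apply_inv, totalWeilCharacter_eq_eigenCount]
  simp [hc]
  ring

end Trace

/-! ### Matrices with prescribed eigenvalues. -/

section Companion

open Polynomial

variable {F : Type*} [Field F]

/-- If f = (X - a)k, the annihilator of X - a in F[X]/(f) is the line spanned by k. If f(a) ≠ 0,
then X - a divides the unit f(a) modulo f, so it annihilates only 0. -/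
theorem natCard_root_mul_eq_smul (f : F[X]) (hf : f.Monic) (a : F) [Decidable (f.IsRoot a)] :
    Nat.card {y : AdjoinRoot f // AdjoinRoot.root f * y = a • y} =
      if f.IsRoot a then Nat.card F else 1 := by
  have key : ∀ y : AdjoinRoot f, AdjoinRoot.root f * y = a • y ↔
      AdjoinRoot.mk f (X - C a) * y = 0 := fun y => by
    rw [map_sub, AdjoinRoot.mk_X, AdjoinRoot.mk_C, sub_mul, sub_eq_zero, Algebra.smul_def]
    rfl
  split_ifs with h
  · obtain ⟨k, hk⟩ := dvd_iff_isRoot.mpr h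
    have hk0 : k ≠ 0 := by
      rintro rfl
      exact hf.ne_zero (by simp [hk])
    have hmk : AdjoinRoot.mk f k ≠ 0 := by
      rw [Ne, AdjoinRoot.mk_eq_zero]
      intro hd
      have h1 := natDegree_le_of_dvd hd hk0
      rw [hk, natDegree_mul (X_sub_C_ne_zero a) hk0, natDegree_X_sub_C] at h1
      omega
    have hz : AdjoinRoot.mk f (X - C a) * AdjoinRoot.mk f k = 0 := by
      rw [← map_mul, ← hk, AdjoinRoot.mk_self]
    symm
    refine Nat.card_congr (Equiv.ofBijective
      (fun c : F => ⟨c • AdjoinRoot.mk f k, (key _).mpr (by rw [mul_smul_comm, hz, smul_zero])⟩)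
      ⟨fun c d hcd => ?_, fun y => ?_⟩)
    · have h1 := Subtype.ext_iff.mp hcd
      rw [← sub_eq_zero, ← sub_smul] at h1
      exact sub_eq_zero.mp ((smul_eq_zero.mp h1).resolve_right hmk)
    · obtain ⟨y, hy⟩ := y
      obtain ⟨p, rfl⟩ := AdjoinRoot.mk_surjective y
      rw [key, ← map_mul, AdjoinRoot.mk_eq_zero] at hy
      nth_rw 1 [hk] at hy
      obtain ⟨r, rfl⟩ := (mul_dvd_mul_iff_left (X_sub_C_ne_zero a)).mp hy
      obtain ⟨s, hs⟩ := X_sub_C_dvd_sub_C_eval (a := a) (p := r)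
      refine ⟨r.eval a, Subtype.ext ?_⟩
      change r.eval a • AdjoinRoot.mk f k = AdjoinRoot.mk f (k * r)
      -- Only the value r(a) matters: r - r(a) is divisible by X - a, so k(r - r(a)) is divisible by
      -- f.
      have e : k * r = f * s + C (r.eval a) * k := by
        rw [hk]
        linear_combination k * hs
      rw [e, map_add, map_mul, AdjoinRoot.mk_self, zero_mul, zero_add, map_mul, Algebra.smul_def]
      rfl
  · obtain ⟨s, hs⟩ := X_sub_C_dvd_sub_C_eval (a := a) (p := f)
    rw [Nat.card_eq_one_iff_unique]
    refine ⟨subsingleton_of_forall_eq ⟨0, by simp⟩ fun y => Subtype.ext ?_, ⟨⟨0, by simp⟩⟩⟩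
    have h1 := (key _).mp y.2
    have h2 : f.eval a • y.1 = 0 := by
      have h3 := congrArg (AdjoinRoot.mk f) hs
      rw [map_sub, AdjoinRoot.mk_self, map_mul, zero_sub, neg_eq_iff_eq_neg] at h3
      rw [Algebra.smul_def]
      change AdjoinRoot.mk f (C (f.eval a)) * y.1 = 0
      rw [h3, mul_comm (AdjoinRoot.mk f (X - C a)), neg_mul, mul_assoc, h1, mul_zero, neg_zero]
    exact (smul_eq_zero.mp h2).resolve_left h

/-- A monic polynomial of degree `n` with constant term `(-1)^n` is the characteristic polynomial
of an element of `SL_n(F)` all of whose eigenspaces are at most one-dimensional. -/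
theorem exists_eigenCount_eq {n : ℕ} (f : F[X]) (hf : f.Monic) (hn : f.natDegree = n)
    (h0 : f.coeff 0 = (-1) ^ n) [DecidablePred f.IsRoot] :
    ∃ g : Matrix.SpecialLinearGroup (Fin n) F, ∀ a : F,
      eigenCount g a = if f.IsRoot a then Nat.card F else 1 := by
  subst hn
  let pb := AdjoinRoot.powerBasis' hf
  let b : Basis (Fin f.natDegree) F (AdjoinRoot f) := pb.basis
  -- The determinant of multiplication by the root is its norm, (-1)^n f(0).
  have hdet : (Algebra.leftMulMatrix b (AdjoinRoot.root f)).det = 1 := by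
    rw [← Algebra.norm_eq_matrix_det b]
    have := Algebra.PowerBasis.norm_gen_eq_coeff_zero_minpoly pb
    have hmin : minpoly F pb.gen = f := by
      change minpoly F (AdjoinRoot.root f) = f
      rw [AdjoinRoot.minpoly_root hf.ne_zero, hf.leadingCoeff, inv_one, map_one, mul_one]
    rw [hmin] at this
    refine this.trans ?_
    change (-1) ^ f.natDegree * f.coeff 0 = 1
    rw [h0, ← mul_pow]
    simp
  refine ⟨⟨_, hdet⟩, fun a => ?_⟩
  rw [← natCard_root_mul_eq_smul f hf a]
  symm
  refine Nat.card_congr (b.equivFun.toEquiv.subtypeEquiv fun y => ?_)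
  change _ ↔ (Algebra.leftMulMatrix b (AdjoinRoot.root f)).mulVec (b.repr y) = a • b.equivFun y
  rw [Algebra.leftMulMatrix_mulVec_repr, ← map_smul]
  exact b.equivFun.injective.eq_iff.symm

/-- A root x is nonzero and gives t = x + d/x; the q - 1 units cannot reach all q values of t. -/
theorem exists_forall_quadratic_ne_zero [Finite F] (d : F) (hd : d ≠ 0) :
    ∃ t : F, ∀ x : F, x ^ 2 - t * x + d ≠ 0 := by
  classical
  let _ : Fintype F := Fintype.ofFinite F
  have hsurj : ¬ Function.Surjective fun r : Fˣ => (r : F) + d / r := fun h => by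
    have h1 := Fintype.card_le_of_surjective _ h
    rw [Fintype.card_units] at h1
    have := Fintype.card_pos (α := F)
    omega
  rw [Function.Surjective] at hsurj
  push Not at hsurj
  obtain ⟨t, ht⟩ := hsurj
  refine ⟨t, fun x hx => ?_⟩
  have hx0 : x ≠ 0 := by
    rintro rfl
    simp [hd] at hx
  refine ht (Units.mk0 x hx0) ?_
  simp only [Units.val_mk0]
  field_simp
  linear_combination hx

end Companion

/-! ### Fourier coefficients and the comparison of degrees. -/

section Coefficients

variable {F : Type*} [Field F] [Fintype F] [DecidableEq F] {n : ℕ}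

/-- The (normalized) Fourier transform of a multiset of characters of `F^×`. -/
def fourierCoeff (t : Multiset (Fˣ →* ℂˣ)) (a : Fˣ) : ℂ :=
  (Fintype.card Fˣ : ℂ)⁻¹ * (t.map fun χ => ((χ a : ℂ))⁻¹).sum

theorem sum_map_weilCharacter [DecidableEq (Fˣ →* ℂˣ)] (hn : 1 ≤ n) (t : Multiset (Fˣ →* ℂˣ))
    (g : Matrix.SpecialLinearGroup (Fin n) F) :
    (t.map (weilCharacter F n)).sum g =
      ∑ a : Fˣ, fourierCoeff t a * ((eigenCount g (a : F) : ℂ) - 1) - t.count 1 := by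
  induction t using Multiset.induction_on with
  | empty => simp [fourierCoeff]
  | cons χ t ih =>
    simp only [Multiset.map_cons, Multiset.sum_cons, Pi.add_apply, ih, weilCharacter_apply hn,
      fourierCoeff, mul_add, add_mul, Finset.sum_add_distrib, Multiset.count_cons, Finset.mul_sum,
      mul_assoc, eq_comm (a := (1 : Fˣ →* ℂˣ))]
    push_cast
    ring

theorem norm_monoidHom_apply (χ : Fˣ →* ℂˣ) (a : Fˣ) : ‖(χ a : ℂ)‖ = 1 := by
  refine Complex.norm_eq_one_of_pow_eq_one (n := Fintype.card Fˣ) ?_ Fintype.card_ne_zero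
  rw [← Units.val_pow_eq_pow_val, ← map_pow, pow_card_eq_one, map_one, Units.val_one]

/-- Character values lie on the unit circle, where inversion is conjugation. -/
theorem fourierCoeff_inv (t : Multiset (Fˣ →* ℂˣ)) (a : Fˣ) :
    fourierCoeff t a⁻¹ = starRingEnd ℂ (fourierCoeff t a) := by
  simp only [fourierCoeff, map_mul, map_inv₀, map_natCast, map_multiset_sum, Multiset.map_map]
  congr 3
  ext χ
  simp [← Complex.inv_eq_conj (norm_monoidHom_apply χ a)]

theorem norm_fourierCoeff_le (t : Multiset (Fˣ →* ℂˣ)) (ht : t.card = Fintype.card Fˣ) (a : Fˣ) :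
    ‖fourierCoeff t a‖ ≤ 1 := by
  have h : ‖(t.map fun χ => ((χ a : ℂ))⁻¹).sum‖ ≤ Fintype.card Fˣ := by
    rw [← ht]
    refine (norm_multiset_sum_le _).trans ?_
    simp [Multiset.map_map, norm_monoidHom_apply]
  have hpos : (0 : ℝ) < Fintype.card Fˣ := by exact_mod_cast Fintype.card_pos
  rw [fourierCoeff, norm_mul, norm_inv, Complex.norm_natCast, inv_mul_le_iff₀ hpos, mul_one]
  exact h

theorem fourierCoeff_one (t : Multiset (Fˣ →* ℂˣ)) (ht : t.card = Fintype.card Fˣ) :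
    fourierCoeff t 1 = 1 := by
  simp [fourierCoeff, ht]

end Coefficients

/-- Here A counts all Weil constituents and b those with χ = 1; the equation is that of degrees,
multiplied by q - 1. With N = (q^n - 1)/(q - 1) ≥ q + 1 it reads AN + 1 = (q - 1)N + b. If A < q - 1
the right side is too large; if A > q - 1 then b would exceed A. -/
theorem eq_and_eq_one_of_mul_eq {q n A b : ℕ} (hq : 2 ≤ q) (hn : 2 ≤ n) (hb : b ≤ A)
    (h : A * (q ^ n - 1) + 2 * (q - 1) = (q - 1) * (q ^ n + b)) : A = q - 1 ∧ b = 1 := by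
  obtain ⟨r, rfl⟩ : ∃ r, q = r + 1 := ⟨q - 1, by omega⟩
  obtain ⟨N, hN⟩ : r ∣ (r + 1) ^ n - 1 := by
    simpa using Nat.sub_dvd_pow_sub_pow (r + 1) 1 n
  have h1 : (r + 1) ^ 2 ≤ (r + 1) ^ n := Nat.pow_le_pow_right (by omega) hn
  have h2 : (r + 1) ^ n = r * N + 1 := by
    have := Nat.one_le_pow n (r + 1) (by omega)
    omega
  have hr : 0 < r := by omega
  have hNr : r + 2 ≤ N := by
    by_contra! hlt
    have : r * N ≤ r * (r + 1) := Nat.mul_le_mul_left _ (by omega)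
    nlinarith
  rw [h2] at h
  simp only [Nat.add_sub_cancel] at h ⊢
  have h3 : A * N + 1 = r * N + b := by
    apply Nat.eq_of_mul_eq_mul_left hr
    nlinarith
  rcases lt_trichotomy A r with hA | hA | hA
  · have : (A + 1) * N ≤ r * N := Nat.mul_le_mul_right _ hA
    nlinarith
  · subst hA
    exact ⟨rfl, by omega⟩
  · obtain ⟨k, rfl⟩ : ∃ k, A = r + 1 + k := ⟨A - (r + 1), by omega⟩
    nlinarith [Nat.zero_le (k * N), Nat.mul_le_mul_left k hNr]

/-! ### Coefficients forced by power-of-q values. -/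

section PrimePowerValues

variable {F : Type*} [Field F] [Fintype F] [DecidableEq F] {n : ℕ}

open Polynomial

/-- A function `h` on `F^×` such that `1 + ∑_a h(a) (#Ker(g - a) - 1)` is always a power of `q`
takes only the values `0` and `1`. -/
theorem eq_zero_or_one_of_pow_values (hn : 3 ≤ n) (h : Fˣ → ℂ) (hnorm : ∀ a, ‖h a‖ ≤ 1)
    (hpow : ∀ g : Matrix.SpecialLinearGroup (Fin n) F, ∃ i : ℕ,
      1 + ∑ a : Fˣ, h a * ((eigenCount g (a : F) : ℂ) - 1) = (Fintype.card F : ℂ) ^ i) (c : Fˣ) :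
    h c = 0 ∨ h c = 1 := by
  classical
  obtain ⟨m, rfl⟩ : ∃ m, n = m + 3 := ⟨n - 3, by omega⟩
  -- With m + 1 = n - 2, the constant term c^(-(n-2)) of the quadratic makes the determinant 1, and
  -- c is the only eigenvalue in F.
  obtain ⟨t, ht⟩ := exists_forall_quadratic_ne_zero (((c⁻¹ : Fˣ) : F) ^ (m + 1))
    (pow_ne_zero _ (Units.ne_zero _))
  have hm2 : (X ^ 2 - C t * X + C (((c⁻¹ : Fˣ) : F) ^ (m + 1))).Monic := by monicity!
  have hd2 : (X ^ 2 - C t * X + C (((c⁻¹ : Fˣ) : F) ^ (m + 1))).natDegree = 2 := by compute_degree!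
  have hm1 := (monic_X_sub_C (c : F)).pow (m + 1)
  obtain ⟨g, hg⟩ := exists_eigenCount_eq (n := m + 3)
    ((X - C (c : F)) ^ (m + 1) * (X ^ 2 - C t * X + C (((c⁻¹ : Fˣ) : F) ^ (m + 1))))
    (hm1.mul hm2) (by
      rw [hm1.natDegree_mul hm2, hd2, natDegree_pow, natDegree_X_sub_C]
      ring) (by
      rw [coeff_zero_eq_eval_zero]
      simp only [eval_mul, eval_pow, eval_sub, eval_X, eval_C, eval_add, zero_sub]
      rw [neg_pow (c : F)]
      simp
      ring)
  have hroot : ∀ a : Fˣ, (eigenCount g (a : F) : ℂ) - 1 =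
      if a = c then (Fintype.card F : ℂ) - 1 else 0 := by
    intro a
    have : ((X - C (c : F)) ^ (m + 1) *
        (X ^ 2 - C t * X + C (((c⁻¹ : Fˣ) : F) ^ (m + 1)))).IsRoot (a : F) ↔ a = c := by
      rw [IsRoot.def, eval_mul, mul_eq_zero, or_iff_left]
      · simp [sub_eq_zero, Units.ext_iff]
      · simpa using ht a
    simp only [hg, this]
    split_ifs <;> simp
  obtain ⟨i, hi⟩ := hpow g
  simp only [hroot, mul_ite, mul_zero, Finset.sum_ite_eq', Finset.mem_univ, if_true] at hi
  have hq : 1 < Fintype.card F := Fintype.one_lt_card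
  have hq0 : (Fintype.card F : ℂ) - 1 ≠ 0 := by
    rw [sub_ne_zero]
    exact_mod_cast hq.ne'
  -- Now 1 + h(c)(q - 1) = q^i: the exponents 0 and 1 give h(c) = 0 and 1, and larger ones
  -- contradict |h(c)| ≤ 1.
  match i with
  | 0 =>
    left
    have : h c * ((Fintype.card F : ℂ) - 1) = 0 := by linear_combination hi
    exact (mul_eq_zero.mp this).resolve_right hq0
  | 1 =>
    right
    have : (h c - 1) * ((Fintype.card F : ℂ) - 1) = 0 := by linear_combination hi
    exact sub_eq_zero.mp ((mul_eq_zero.mp this).resolve_right hq0)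
  | i + 2 =>
    exfalso
    have hqr : (1 : ℝ) < Fintype.card F := by exact_mod_cast hq
    have h1 : (Fintype.card F : ℂ) ^ (i + 2) - 1 = h c * ((Fintype.card F : ℂ) - 1) := by
      linear_combination -hi
    have h2 : ((Fintype.card F : ℝ) ^ (i + 2) - 1) ≤ (Fintype.card F : ℝ) - 1 := by
      have h3 := congrArg norm h1
      rw [norm_mul] at h3
      have e1 : (Fintype.card F : ℂ) ^ (i + 2) - 1 =
          (((Fintype.card F : ℝ) ^ (i + 2) - 1 : ℝ) : ℂ) := by push_cast; ring
      have e2 : (Fintype.card F : ℂ) - 1 = (((Fintype.card F : ℝ) - 1 : ℝ) : ℂ) := by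
        push_cast; ring
      rw [e1, e2, Complex.norm_real, Complex.norm_real, Real.norm_eq_abs, Real.norm_eq_abs,
        abs_of_nonneg (sub_nonneg.mpr hqr.le)] at h3
      calc _ ≤ _ := le_abs_self _
        _ = _ := h3
        _ ≤ 1 * ((Fintype.card F : ℝ) - 1) :=
          mul_le_mul_of_nonneg_right (hnorm c) (sub_nonneg.mpr hqr.le)
        _ = _ := one_mul _
    have h4 := pow_lt_pow_right₀ hqr (show 1 < i + 2 by omega)
    linarith

/-- If h(c) = 1, then h(c⁻¹) = 1 by conjugation, and an element with eigenvalues 1, c, c⁻¹ gives the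
value 1 + k(q - 1) with k ∈ {2, 3}, which is never a power of q when q ≥ 3. -/
theorem eq_zero_of_pow_values (hn : 3 ≤ n) (h : Fˣ → ℂ) (hnorm : ∀ a, ‖h a‖ ≤ 1) (h1 : h 1 = 1)
    (hinv : ∀ a, h a⁻¹ = starRingEnd ℂ (h a))
    (hpow : ∀ g : Matrix.SpecialLinearGroup (Fin n) F, ∃ i : ℕ,
      1 + ∑ a : Fˣ, h a * ((eigenCount g (a : F) : ℂ) - 1) = (Fintype.card F : ℂ) ^ i) {c : Fˣ}
    (hc : c ≠ 1) : h c = 0 := by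
  classical
  refine (eq_zero_or_one_of_pow_values hn h hnorm hpow c).resolve_right fun hc1 => ?_
  have hc2 : h c⁻¹ = 1 := by rw [hinv, hc1, map_one]
  obtain ⟨m, rfl⟩ : ∃ m, n = m + 3 := ⟨n - 3, by omega⟩
  have hm1 := (monic_X_sub_C (1 : F)).pow (m + 1)
  have hm2 := monic_X_sub_C (c : F)
  have hm3 := monic_X_sub_C ((c⁻¹ : Fˣ) : F)
  obtain ⟨g, hg⟩ := exists_eigenCount_eq (n := m + 3)
    ((X - C 1) ^ (m + 1) * (X - C (c : F)) * (X - C ((c⁻¹ : Fˣ) : F)))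
    ((hm1.mul hm2).mul hm3) (by
      rw [(hm1.mul hm2).natDegree_mul hm3, hm1.natDegree_mul hm2, natDegree_pow]
      simp only [natDegree_X_sub_C]
      ring) (by
      rw [coeff_zero_eq_eval_zero]
      simp
      ring)
  -- As c = c⁻¹ is possible, S has two or three elements.
  let S : Finset Fˣ := {1, c, c⁻¹}
  have hroot : ∀ a : Fˣ, h a * ((eigenCount g (a : F) : ℂ) - 1) =
      if a ∈ S then (Fintype.card F : ℂ) - 1 else 0 := by
    intro a
    have : ((X - C 1) ^ (m + 1) * (X - C (c : F)) * (X - C ((c⁻¹ : Fˣ) : F))).IsRoot (a : F) ↔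
        a ∈ S := by
      rw [IsRoot.def]
      simp only [eval_mul, eval_pow, eval_sub, eval_X, eval_C, mul_eq_zero, pow_eq_zero_iff',
        sub_eq_zero, S, Finset.mem_insert, Finset.mem_singleton, or_assoc, Units.ext_iff,
        Units.val_one, Ne, Nat.add_eq_zero_iff, one_ne_zero, and_false, not_false_eq_true, and_true]
    simp only [hg, this]
    split_ifs with ha
    · have : h a = 1 := by
        simp only [S, Finset.mem_insert, Finset.mem_singleton] at ha
        rcases ha with rfl | rfl | rfl <;> assumption
      rw [this, one_mul, Nat.card_eq_fintype_card]
    · simp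
  obtain ⟨i, hi⟩ := hpow g
  simp only [hroot, Finset.sum_ite_mem, Finset.univ_inter, Finset.sum_const, nsmul_eq_mul] at hi
  have hS2 : 2 ≤ S.card := by
    rw [← Finset.card_pair (Ne.symm hc)]
    exact Finset.card_le_card (by intro x; simp [S]; tauto)
  have hS3 : S.card ≤ 3 := Finset.card_le_three
  have hq : 3 ≤ Fintype.card F := by
    have h2 : 1 < Fintype.card Fˣ := Fintype.one_lt_card_iff.mpr ⟨c, 1, hc⟩
    rw [Fintype.card_units] at h2
    omega
  obtain ⟨r, hr⟩ : ∃ r, Fintype.card F = r + 1 := ⟨Fintype.card F - 1, by omega⟩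
  have hi' : 1 + S.card * r = (r + 1) ^ i := by
    rw [hr] at hi
    push_cast at hi
    rw [add_sub_cancel_right] at hi
    exact_mod_cast hi
  match i with
  | 0 =>
    rw [pow_zero] at hi'
    have : 0 < S.card * r := Nat.mul_pos (by omega) (by omega)
    omega
  | i + 1 =>
    obtain ⟨k, hk⟩ : ∃ k, S.card = k + 1 := ⟨S.card - 1, by omega⟩
    -- With q = r + 1 and |S| = k + 1, the value is (k + 1)q - k, so q divides k ∈ {1, 2}, although
    -- q ≥ 3.
    have hdvd : r + 1 ∣ k := by
      have hA : (r + 1 : ℤ) ∣ k := by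
        refine ⟨k + 1 - (r + 1) ^ i, ?_⟩
        have : (1 : ℤ) + S.card * r = (r + 1) ^ (i + 1) := by exact_mod_cast hi'
        rw [hk] at this
        push_cast at this
        rw [pow_succ] at this
        linear_combination -this
      exact_mod_cast hA
    have := Nat.le_of_dvd (by omega) hdvd
    omega

end PrimePowerValues

end WeilSL

end

/-! ### The main theorem. -/

theorem mainTheorem9 {F : Type*} [Field F] [Fintype F] [DecidableEq F] {p q n : ℕ}
    (hp : p.Prime) (hq : ∃ k : ℕ, 0 < k ∧ q = p ^ k) (hF : Fintype.card F = q) (hn : 3 ≤ n)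
    (ψ : Matrix.SpecialLinearGroup (Fin n) F → ℂ)
    (hψ : WeilSL.IsCharacter ψ) (hred : ¬ WeilSL.IsIrreducibleCharacter ψ)
    (ha : ψ 1 = (q : ℂ) ^ n)
    (hb : ∀ g, ∃ i : ℕ, i ≤ n ∧ ψ g = (q : ℂ) ^ i)
    (hc : WeilSL.charInner ψ 1 = 2)
    (hd : ∀ φ : Matrix.SpecialLinearGroup (Fin n) F → ℂ,
      WeilSL.IsIrreducibleConstituent φ (ψ - 2 • 1) →
        ∃ χ : Fˣ →* ℂˣ, φ = WeilSL.weilCharacter F n χ) :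
    ψ = WeilSL.totalWeilCharacter F n ∧
      ψ = 2 • 1 + ∑ᶠ χ : Fˣ →* ℂˣ, WeilSL.weilCharacter F n χ := by
  classical
  suffices h : ψ = WeilSL.totalWeilCharacter F n from
    ⟨h, h.trans (WeilSL.totalWeilCharacter_eq_add_sum (by omega))⟩
  obtain ⟨s, hs, hψs⟩ := WeilSL.exists_multiset_constituents hψ (m := 2) (by exact_mod_cast hc)
  choose! w hw using fun φ hφ => hd φ (hs φ hφ)
  have hsw : s = (s.map w).map (WeilSL.weilCharacter F n) := by
    rw [Multiset.map_map]
    conv_lhs => rw [← Multiset.map_id s]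
    exact Multiset.map_congr rfl hw
  generalize s.map w = t at hsw
  have hψt : ∀ g, ψ g = 2 + (∑ a : Fˣ, WeilSL.fourierCoeff t a *
      ((WeilSL.eigenCount g (a : F) : ℂ) - 1) - t.count 1) := by
    intro g
    rw [← WeilSL.sum_map_weilCharacter (by omega), ← hsw]
    conv_lhs => rw [hψs]
    simp
  have hq2 : 1 < q := hF ▸ Fintype.one_lt_card
  have hunits : Fintype.card Fˣ = q - 1 := by rw [Fintype.card_units, hF]
  have hu0 : ((q - 1 : ℕ) : ℂ) ≠ 0 := by
    rw [Nat.cast_ne_zero]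
    omega
  -- Evaluation at g = 1, where only the eigenvalue 1 contributes, compares degrees.
  obtain ⟨hcard, hcount⟩ : t.card = q - 1 ∧ t.count 1 = 1 := by
    refine WeilSL.eq_and_eq_one_of_mul_eq (n := n) hq2 (by omega) (Multiset.count_le_card 1 t) ?_
    have h1 := hψt 1
    have hval : ∀ a : Fˣ, ((WeilSL.eigenCount (1 : Matrix.SpecialLinearGroup (Fin n) F) (a : F) :
        ℂ) - 1) = if a = 1 then (q : ℂ) ^ n - 1 else 0 := by
      intro a
      simp only [WeilSL.eigenCount_one, Units.val_eq_one, hF]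
      split_ifs <;> simp
    simp only [hval, mul_ite, mul_zero, Finset.sum_ite_eq', Finset.mem_univ, if_true, ha,
      WeilSL.fourierCoeff, hunits, map_one, Units.val_one, inv_one, Multiset.map_const',
      Multiset.sum_replicate, nsmul_eq_mul, mul_one] at h1
    field_simp at h1
    have hle : 1 ≤ q ^ n := Nat.one_le_pow _ _ (by omega)
    have : ((t.card * (q ^ n - 1) + 2 * (q - 1) : ℕ) : ℂ) =
        (((q - 1) * (q ^ n + t.count 1) : ℕ) : ℂ) := by
      push_cast [Nat.cast_sub hle] at h1 ⊢
      linear_combination -h1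
    exact_mod_cast this
  have hψ1 : ∀ g, ψ g = 1 + ∑ a : Fˣ, WeilSL.fourierCoeff t a *
      ((WeilSL.eigenCount g (a : F) : ℂ) - 1) := by
    intro g
    rw [hψt, hcount]
    push_cast
    ring
  have hcard' : t.card = Fintype.card Fˣ := hcard.trans hunits.symm
  have hzero : ∀ a : Fˣ, a ≠ 1 → WeilSL.fourierCoeff t a = 0 := fun a ha =>
    WeilSL.eq_zero_of_pow_values hn _ (WeilSL.norm_fourierCoeff_le t hcard')
      (WeilSL.fourierCoeff_one t hcard') (WeilSL.fourierCoeff_inv t)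
      (fun g => by
        obtain ⟨i, -, hi⟩ := hb g
        exact ⟨i, by rw [← hψ1, hi, hF]⟩) ha
  -- Only the term a = 1, with coefficient 1, remains: ψ(g) = 1 + (N_g(1) - 1).
  ext g
  rw [hψ1, WeilSL.totalWeilCharacter_eq_eigenCount, Finset.sum_eq_single 1
    (fun a _ ha => by rw [hzero a ha, zero_mul]) (by simp), WeilSL.fourierCoeff_one t hcard']
  simp
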